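/- Let $\mathbb K$ be a field, $\lambda \in \mathbb K$, $\ell \ge 1$, and let $k_1,\dots,k_\ell \ge 1$ and $r_1 > \cdots > r_\ell \ge 1$ be integers. Let $J_\lambda = \bigoplus_{a=1}^{\ell} k_a J_{\lambda,r_a}$ be the Jordan matrix that is the direct sum, over $a=1,\dots,\ell$, of $k_a$ copies of the Jordan block $J_{\lambda,r_a}$ of size $r_a$ with eigenvalue $\lambda$ (with $1$'s on the superdiagonal). Its rows are indexed by $$\Lambda = \{(i_1,i_2,i_3) \in \mathbb N^3 \mid 1\le i_1\le \ell,\ 1\le i_2\le k_{i_1},\ 1\le i_3\le r_{i_1}\},$$ where $(i_1,i_2,i_3)$ stands for the $i_3$-th row of the $i_2$-th block of size $r_{i_1}$. Order $\Lambda$ totally by $\boldsymbol i > \boldsymbol j$ if and only if $i_1<j_1$, or $i_1=j_1$ and $i_2<j_2$, or $i_1=j_1$, $i_2=j_2$ and $i_3<j_3$. Let $R=\mathbb K[x(\boldsymbol i) \mid \boldsymbol i\in\Lambda]$, let $\boldsymbol x$ be the column vector of the variables, and let $I_\lambda\subseteq R$ be the ideal generated by the $2\times 2$ minors of the augmented matrix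 $(J_\lambda \boldsymbol x \mid \boldsymbol x)$. Let $>_{\mathrm{grevlex}}$ be the graded reverse lexicographic order on the monomials of $R$ with $x(\boldsymbol i)>x(\boldsymbol j)$ if and only if $\boldsymbol i>\boldsymbol j$. For $\boldsymbol i=(i_1,i_2,i_3)\in\Lambda$ with $i_3<r_{i_1}$ write $\boldsymbol i^+=(i_1,i_2,i_3+1)$. Let $\Gamma_1$, $\Gamma_2$ and $\Gamma_3$ be the sets of those pairs $(\boldsymbol i,\boldsymbol j)\in\Lambda\times\Lambda$ with $\boldsymbol i>\boldsymbol j$ and $i_3<r_{i_1}$ for which, respectively, * ($\Gamma_1$) $j_3<r_{j_1}$ and $i_3+j_3\ge r_{j_1}+1$; * ($\Gamma_2$) $j_3<r_{j_1}$ and $i_3+j_3\le r_{j_1}$; * ($\Gamma_3$) $j_3=r_{j_1}$. For $(\boldsymbol i,\boldsymbol j)\in\Gamma_2$ write $\boldsymbol i^*=(i_1,i_2,1)$ and $\boldsymbol j^*=(j_1,j_2,i_3+j_3)$. Set $$G_1=\{x(\boldsymbol i^+)x(\boldsymbol j)\mid (\boldsymbol i,\boldsymbol j)\in\Gamma_1\cup\Gamma_3\},\qquad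 G_2=\{x(\boldsymbol i^+)x(\boldsymbol j)-x(\boldsymbol i^*)x(\boldsymbol j^*)\mid (\boldsymbol i,\boldsymbol j)\in\Gamma_2\},$$ and let $G=\{0\}$ if $r_1=1$ and $G=G_1\cup G_2$ otherwise. Then $G$ is a reduced Gröbner basis of $I_\lambda$ with respect to $>_{\mathrm{grevlex}}$. That is: $G$ is a finite subset of $I_\lambda$ whose leading terms generate the initial ideal of $I_\lambda$ (the ideal generated by the leading terms of all elements of $I_\lambda$); and, if $I_\lambda\ne 0$, every $g\in G$ has leading coefficient $1$ and no monomial occurring in $g$ lies in the ideal generated by the leading terms of the elements of $G\setminus\{g\}$. (For the zero ideal, by convention, the reduced Gröbner basis is $\{0\}$.) -/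

import Mathlib

open MvPolynomial

/-! ### The graded reverse lexicographic order -/

/-- The exponent vectors `σ →₀ ℕ`, to be ordered by the graded reverse lexicographic order. -/
def Grevlex (σ : Type*) : Type _ := σ →₀ ℕ

namespace Grevlex

noncomputable instance (σ : Type*) : AddCommMonoid (Grevlex σ) :=
  inferInstanceAs (AddCommMonoid (σ →₀ ℕ))

/-- The identity map from exponent vectors to `Grevlex σ`. -/
noncomputable def equiv (σ : Type*) : (σ →₀ ℕ) ≃+ Grevlex σ := AddEquiv.refl _

/-- The sorting key of an exponent vector: first the total degree; among exponent vectors of the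
same total degree, the reverse of the lexicographic comparison that starts from the smallest
variable. -/
noncomputable def key {σ : Type*} (a : Grevlex σ) : ℕ ×ₗ (Lex (σ →₀ ℕ))ᵒᵈ :=
  toLex (((equiv σ).symm a).degree, OrderDual.toDual (toLex ((equiv σ).symm a)))

theorem key_injective (σ : Type*) : Function.Injective (key (σ := σ)) := by
  intro a b h
  simp only [key, EmbeddingLike.apply_eq_iff_eq, Prod.mk.injEq] at h
  exact h.2

noncomputable instance (σ : Type*) [LinearOrder σ] : LinearOrder (Grevlex σ) :=
  LinearOrder.lift' key (key_injective σ)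

/-- `a < b` iff `a` has smaller total degree, or the total degrees agree and, at the smallest
variable whose exponents differ, `a` has the larger exponent. -/
theorem lt_iff {σ : Type*} [LinearOrder σ] (a b : σ →₀ ℕ) :
    equiv σ a < equiv σ b ↔ a.degree < b.degree ∨
      (a.degree = b.degree ∧ ∃ i, (∀ j < i, a j = b j) ∧ b i < a i) := by
  change key (equiv σ a) < key (equiv σ b) ↔ _
  simp only [key, Prod.Lex.toLex_lt_toLex, AddEquiv.symm_apply_apply, OrderDual.toDual_lt_toDual,
    Finsupp.Lex.lt_iff, ofLex_toLex]
  constructor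
  · rintro (h | ⟨h, i, hi, h'⟩)
    · exact Or.inl h
    · exact Or.inr ⟨h, i, fun j hj => (hi j hj).symm, h'⟩
  · rintro (h | ⟨h, i, hi, h'⟩)
    · exact Or.inl h
    · exact Or.inr ⟨h, i, fun j hj => (hi j hj).symm, h'⟩

theorem add_lt_add_iff {σ : Type*} [LinearOrder σ] (a b c : σ →₀ ℕ) :
    equiv σ (a + c) < equiv σ (b + c) ↔ equiv σ a < equiv σ b := by
  rw [lt_iff, lt_iff]
  simp

instance (σ : Type*) [LinearOrder σ] : IsOrderedAddMonoid (Grevlex σ) where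
  add_le_add_left a b h c := not_lt.1 fun h' => not_lt.2 h <|
    (add_lt_add_iff ((equiv σ).symm b) ((equiv σ).symm a) ((equiv σ).symm c)).1 h'

theorem degree_le {σ : Type*} [LinearOrder σ] {a b : σ →₀ ℕ} (h : equiv σ a ≤ equiv σ b) :
    a.degree ≤ b.degree := by
  by_contra! h'
  exact not_lt.2 h ((lt_iff b a).2 (Or.inl h'))

instance (σ : Type*) [LinearOrder σ] [Finite σ] : WellFoundedLT (Grevlex σ) := by
  refine ⟨WellFounded.wellFounded_iff_has_min.2 fun s ⟨a, ha⟩ => ?_⟩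
  have hfin : {b : Grevlex σ | b ∈ s ∧ b ≤ a}.Finite := by
    have : {b : σ →₀ ℕ | b.degree ≤ ((equiv σ).symm a).degree}.Finite :=
      Finsupp.finite_of_degree_le _
    exact this.subset fun b hb => degree_le (b := (equiv σ).symm a) hb.2
  obtain ⟨b, hb⟩ := hfin.exists_minimal ⟨a, ha, le_rfl⟩
  refine ⟨b, hb.prop.1, fun c hc hcb => ?_⟩
  exact not_lt.2 (hb.le_of_le ⟨hc, hcb.le.trans hb.prop.2⟩ hcb.le) hcb

end Grevlex

/-- The graded reverse lexicographic order on the monomials in variables indexed by `σ`, where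
the variables are ordered as their indices are. -/
noncomputable def grevlex (σ : Type*) [LinearOrder σ] [Finite σ] : MonomialOrder σ where
  syn := Grevlex σ
  toSyn := Grevlex.equiv σ
  toSyn_monotone a b h := by
    refine not_lt.1 fun h' => ?_
    have hle : a.degree ≤ b.degree := by
      rw [← add_tsub_cancel_of_le h, map_add]
      exact Nat.le_add_right _ _
    rcases (Grevlex.lt_iff b a).1 h' with h' | ⟨hd, i, -, hi⟩
    · exact absurd hle (not_le.2 h')
    · have h2 : b.degree = a.degree + (b - a).degree := by
        rw [← map_add, add_tsub_cancel_of_le h]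
      have h3 : b - a = 0 := (Finsupp.degree_eq_zero_iff _).1 (by omega)
      have h4 := congrArg (fun f => f i) h3
      simp only [Finsupp.tsub_apply, Finsupp.coe_zero, Pi.zero_apply] at h4
      omega

/-! ### Gröbner bases -/

/-- `G` is a Gröbner basis of `I`: a finite subset of `I` whose leading terms generate the initial
ideal, that is, the ideal generated by the leading terms of all elements of `I`. -/
def IsGroebnerBasis {σ K : Type*} [Field K] (m : MonomialOrder σ) (G : Set (MvPolynomial σ K))
    (I : Ideal (MvPolynomial σ K)) : Prop :=
  G.Finite ∧ G ⊆ (I : Set (MvPolynomial σ K)) ∧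
    Ideal.span (m.leadingTerm '' G) = Ideal.span (m.leadingTerm '' (I : Set (MvPolynomial σ K)))

/-- `G` is a reduced Gröbner basis of `I`. For `I ≠ 0`, this means: `G` is a Gröbner basis of `I`,
every element of `G` has leading coefficient `1`, and no monomial that occurs in some `g ∈ G` lies
in the ideal generated by the leading terms of the other elements of `G`. By convention, the
reduced Gröbner basis of the zero ideal is `{0}`. -/
def IsReducedGroebnerBasis {σ K : Type*} [Field K] (m : MonomialOrder σ)
    (G : Set (MvPolynomial σ K)) (I : Ideal (MvPolynomial σ K)) : Prop :=
  IsGroebnerBasis m G I ∧ (I = ⊥ → G = {0}) ∧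
    (I ≠ ⊥ → (∀ g ∈ G, m.leadingCoeff g = 1) ∧
      ∀ g ∈ G, ∀ d ∈ g.support,
        monomial d (1 : K) ∉ Ideal.span (m.leadingTerm '' (G \ {g})))

/-! ### The ideal of a square matrix -/

/-- The augmented matrix `(A x | x)`, where `x` is the column vector of the variables. -/
noncomputable def augmentedMatrix {n K : Type*} [Fintype n] [Field K] (A : Matrix n n K) :
    Matrix n (Fin 2) (MvPolynomial n K) :=
  Matrix.of fun i => ![(A.map (C : K →+* MvPolynomial n K)).mulVec X i, X i]

/-- The ideal generated by the `2 × 2` minors of `(A x | x)`. -/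
noncomputable def matrixIdeal {n K : Type*} [Fintype n] [Field K] (A : Matrix n n K) :
    Ideal (MvPolynomial n K) :=
  Ideal.span {p | ∃ i j : n, p = ((augmentedMatrix A).submatrix ![i, j] id).det}

/-! ### Jordan matrices with a single eigenvalue -/

/-- The index set of the rows of a Jordan matrix with `k a` Jordan blocks of size `r a` for each
`a = 1, …, ℓ`: the triple `(a, b, c)` stands for the `c`-th row of the `b`-th block of size
`r a`. All three indices start at `1`. -/
@[ext]
structure JordanIndex (ℓ : ℕ) (k r : ℕ → ℕ) where
  /-- the index of the block size -/
  a : ℕ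
  /-- the copy of the block of that size -/
  b : ℕ
  /-- the row in the block -/
  c : ℕ
  one_le_a : 1 ≤ a
  a_le : a ≤ ℓ
  one_le_b : 1 ≤ b
  b_le : b ≤ k a
  one_le_c : 1 ≤ c
  c_le : c ≤ r a

namespace JordanIndex

variable {ℓ : ℕ} {k r : ℕ → ℕ}

/-- `i > j` iff `i` comes first lexicographically. -/
noncomputable instance : LinearOrder (JordanIndex ℓ k r) :=
  LinearOrder.lift' (fun i => OrderDual.toDual (toLex (i.a, toLex (i.b, i.c)))) (by
    intro i j h
    simp only [EmbeddingLike.apply_eq_iff_eq, Prod.mk.injEq] at h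
    exact JordanIndex.ext h.1 h.2.1 h.2.2)

theorem gt_iff (i j : JordanIndex ℓ k r) :
    i > j ↔ i.a < j.a ∨ (i.a = j.a ∧ i.b < j.b) ∨ (i.a = j.a ∧ i.b = j.b ∧ i.c < j.c) := by
  change OrderDual.toDual (toLex (j.a, toLex (j.b, j.c))) <
    OrderDual.toDual (toLex (i.a, toLex (i.b, i.c))) ↔ _
  rw [OrderDual.toDual_lt_toDual, Prod.Lex.toLex_lt_toLex, Prod.Lex.toLex_lt_toLex]
  simp only
  tauto

instance : Finite (JordanIndex ℓ k r) :=
  Finite.of_injective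
    (β := (a : Fin (ℓ + 1)) × (Fin (k a + 1) × Fin (r a + 1)))
    (fun i => ⟨⟨i.a, Nat.lt_succ_of_le i.a_le⟩,
      ⟨i.b, Nat.lt_succ_of_le i.b_le⟩, ⟨i.c, Nat.lt_succ_of_le i.c_le⟩⟩) (by
    rintro ⟨a, b, c, _, _, _, _, _, _⟩ ⟨a', b', c', _, _, _, _, _, _⟩ h
    simp only [Sigma.mk.injEq, Fin.mk.injEq] at h
    obtain ⟨rfl, h⟩ := h
    simpa using h)

noncomputable instance : Fintype (JordanIndex ℓ k r) := Fintype.ofFinite _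

/-- The index of the `c`-th row of the Jordan block that contains `i`. -/
def atRow (i : JordanIndex ℓ k r) (c : ℕ) (h1 : 1 ≤ c) (h2 : c ≤ r i.a) : JordanIndex ℓ k r where
  a := i.a
  b := i.b
  c := c
  one_le_a := i.one_le_a
  a_le := i.a_le
  one_le_b := i.one_le_b
  b_le := i.b_le
  one_le_c := h1
  c_le := h2

/-- `i⁺`, the index of the next row of the same Jordan block. -/
def succRow (i : JordanIndex ℓ k r) (h : i.c < r i.a) : JordanIndex ℓ k r :=
  i.atRow (i.c + 1) (Nat.le_add_left 1 i.c) h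

/-- `i^*`, the index of the first row of the same Jordan block. -/
def firstRow (i : JordanIndex ℓ k r) : JordanIndex ℓ k r :=
  i.atRow 1 le_rfl (i.one_le_c.trans i.c_le)

end JordanIndex

/-- The direct sum over `a = 1, …, ℓ` of `k a` copies of the Jordan block of size `r a` with
eigenvalue `lam`: within each block, `lam` on the diagonal and `1` on the superdiagonal. -/
noncomputable def jordanMatrix {K : Type*} [Field K] (ℓ : ℕ) (k r : ℕ → ℕ) (lam : K) :
    Matrix (JordanIndex ℓ k r) (JordanIndex ℓ k r) K :=
  Matrix.of fun i j =>
    if i.a = j.a ∧ i.b = j.b then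
      if j.c = i.c then lam else if j.c = i.c + 1 then 1 else 0
    else 0

/-! ### The set `G` -/

section

variable {ℓ : ℕ} {k r : ℕ → ℕ}

/-- The index pairs `i > j`, neither the last row of its block, with `i₃ + j₃ ≥ r_{j₁} + 1`. -/
structure Gamma₁ (i j : JordanIndex ℓ k r) : Prop where
  gt : i > j
  left_lt : i.c < r i.a
  right_lt : j.c < r j.a
  add_ge : r j.a + 1 ≤ i.c + j.c

/-- The index pairs `i > j`, neither the last row of its block, with `i₃ + j₃ ≤ r_{j₁}`. -/
structure Gamma₂ (i j : JordanIndex ℓ k r) : Prop where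
  gt : i > j
  left_lt : i.c < r i.a
  right_lt : j.c < r j.a
  add_le : i.c + j.c ≤ r j.a

/-- The index pairs `i > j` with `j`, but not `i`, the last row of its block. -/
structure Gamma₃ (i j : JordanIndex ℓ k r) : Prop where
  gt : i > j
  left_lt : i.c < r i.a
  right_eq : j.c = r j.a

end

/-- The monomials `x(i⁺) x(j)` with `(i, j) ∈ Γ₁ ∪ Γ₃`. -/
def groebnerG₁ (K : Type*) [Field K] (ℓ : ℕ) (k r : ℕ → ℕ) :
    Set (MvPolynomial (JordanIndex ℓ k r) K) :=
  {p | ∃ (i j : JordanIndex ℓ k r) (h : Gamma₁ i j ∨ Gamma₃ i j),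
    p = X (i.succRow (h.elim Gamma₁.left_lt Gamma₃.left_lt)) * X j}

/-- The binomials `x(i⁺) x(j) - x(i^*) x(j^*)` with `(i, j) ∈ Γ₂`, where `i^* = (i₁, i₂, 1)` and
`j^* = (j₁, j₂, i₃ + j₃)`. -/
def groebnerG₂ (K : Type*) [Field K] (ℓ : ℕ) (k r : ℕ → ℕ) :
    Set (MvPolynomial (JordanIndex ℓ k r) K) :=
  {p | ∃ (i j : JordanIndex ℓ k r) (h : Gamma₂ i j),
    p = X (i.succRow h.left_lt) * X j -
      X i.firstRow * X (j.atRow (i.c + j.c) (i.one_le_c.trans (Nat.le_add_right _ _)) h.add_le)}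

/-- The set `G`: `{0}` if all blocks have size `1`, and `G₁ ∪ G₂` otherwise. -/
def groebnerG (K : Type*) [Field K] (ℓ : ℕ) (k r : ℕ → ℕ) :
    Set (MvPolynomial (JordanIndex ℓ k r) K) :=
  if r 1 = 1 then {0} else groebnerG₁ K ℓ k r ∪ groebnerG₂ K ℓ k r

/-! Subtracting `lam` times the second column from the first leaves the minors unchanged, so they
are those of the matrix whose first column holds the next variable of each block, or 0 past its end.
Sums of minors give `x(i⁺) x(j) - x(i^*) x(j^*)`, where `x(j^*)` is 0 beyond the block; these
relations are exactly `G₁ ∪ G₂`, and grevlex selects `x(i⁺) x(j)` because `j^*` is the smallest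
variable involved.

The substance is that no nonzero `f` in the ideal has a standard leading exponent, one divisible by
no `x(i⁺) x(j)` with `i > j`. Send `x(i)` to `y(i₁, i₂) t ^ (i₃ - 1)`. The ideal lands in the
monomial ideal generated by all `y(i₁, i₂) t ^ r_{i₁}` (`blockHom_mem_blockIdeal`). A standard
monomial has an image outside that monomial ideal (`IsStandardExponent.blockExponent_none_lt`) and
is the grevlex-smallest monomial with its image (`IsStandardExponent.eq_of_blockExponent_eq_of_le`).
If the leading monomial of `f` were standard, no other term of `f` could cancel its image, so the
image of `f` would have a forbidden monomial.

Reducedness is a comparison of quadratic monomials: leading exponents determine their pairs, and no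
`x(i^*) x(j^*)` is a leading monomial. -/

namespace JordanIndex

/-! ### Order on the indices and variables of a block -/

variable {ℓ : ℕ} {k r : ℕ → ℕ}

theorem le_succRow_of_lt {i j : JordanIndex ℓ k r} (h : i.c < r i.a) (hij : j < i) :
    j ≤ i.succRow h := by
  rw [← gt_iff_lt, gt_iff] at hij
  rw [← not_lt, ← gt_iff_lt, gt_iff]
  simp only [succRow, atRow]
  omega

theorem succRow_inj {i j : JordanIndex ℓ k r} {hi : i.c < r i.a} {hj : j.c < r j.a}
    (h : i.succRow hi = j.succRow hj) : i = j := by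
  simp only [succRow, atRow, JordanIndex.ext_iff] at h ⊢
  omega

theorem le_firstRow (i : JordanIndex ℓ k r) : i ≤ i.firstRow := by
  rw [← not_lt, ← gt_iff_lt, gt_iff]
  have := i.one_le_c
  simp only [firstRow, atRow]
  omega

theorem atRow_lt {i : JordanIndex ℓ k r} {c : ℕ} (h1 : 1 ≤ c) (h2 : c ≤ r i.a) (h : i.c < c) :
    i.atRow c h1 h2 < i :=
  (gt_iff _ _).2 (Or.inr (Or.inr ⟨rfl, rfl, h⟩))

/-- The variable in row `c` of the Jordan block that contains `i`, or `0` if there is no such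
row. -/
noncomputable def rowVar (K : Type*) [Field K] (i : JordanIndex ℓ k r) (c : ℕ) :
    MvPolynomial (JordanIndex ℓ k r) K :=
  if h : 1 ≤ c ∧ c ≤ r i.a then X (i.atRow c h.1 h.2) else 0

variable {K : Type*} [Field K]

theorem rowVar_of_le (i : JordanIndex ℓ k r) {c : ℕ} (h1 : 1 ≤ c) (h2 : c ≤ r i.a) :
    rowVar K i c = X (i.atRow c h1 h2) := dif_pos ⟨h1, h2⟩

theorem rowVar_of_lt (i : JordanIndex ℓ k r) {c : ℕ} (h : r i.a < c) : rowVar K i c = 0 :=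
  dif_neg fun h' => by omega

theorem rowVar_self (i : JordanIndex ℓ k r) : rowVar K i i.c = X i :=
  rowVar_of_le i i.one_le_c i.c_le

theorem rowVar_succ (i : JordanIndex ℓ k r) (h : i.c < r i.a) :
    rowVar K i (i.c + 1) = X (i.succRow h) :=
  rowVar_of_le i _ _

theorem rowVar_one (i : JordanIndex ℓ k r) : rowVar K i 1 = X i.firstRow :=
  rowVar_of_le i _ _

theorem rowVar_atRow (i : JordanIndex ℓ k r) {c : ℕ} (h1 : 1 ≤ c) (h2 : c ≤ r i.a) (d : ℕ) :
    rowVar K (i.atRow c h1 h2) d = rowVar K i d := rfl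

end JordanIndex

open JordanIndex

section

variable {K : Type*} [Field K] {ℓ : ℕ} {k r : ℕ → ℕ}

/-! ### The minors and the membership of `G` in the ideal -/

theorem jordanMatrix_mulVec_X (lam : K) (i : JordanIndex ℓ k r) :
    ((jordanMatrix ℓ k r lam).map (C : K →+* MvPolynomial (JordanIndex ℓ k r) K)).mulVec X i =
      C lam * X i + rowVar K i (i.c + 1) := by
  classical
  have hJ : ∀ j : JordanIndex ℓ k r, (C (jordanMatrix ℓ k r lam i j) * X j :
      MvPolynomial (JordanIndex ℓ k r) K) = (if j = i then C lam * X j else 0) +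
        if j.a = i.a ∧ j.b = i.b ∧ j.c = i.c + 1 then X j else 0 := by
    intro j
    simp only [jordanMatrix, Matrix.of_apply, JordanIndex.ext_iff]
    split_ifs <;> first | omega | simp
  simp only [Matrix.mulVec, dotProduct, Matrix.map_apply, hJ, Finset.sum_add_distrib,
    Finset.sum_ite_eq', Finset.mem_univ, if_true, add_right_inj]
  by_cases h : i.c < r i.a
  · rw [rowVar_succ i h, Finset.sum_eq_single (i.succRow h)]
    · simp [succRow, atRow]
    · intro j _ hj
      rw [if_neg]
      rintro ⟨ha, hb, hc⟩
      exact hj (JordanIndex.ext ha hb hc)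
    · simp
  · rw [rowVar_of_lt i (by omega)]
    refine Finset.sum_eq_zero fun j _ => if_neg ?_
    rintro ⟨ha, hb, hc⟩
    have := j.c_le
    rw [ha] at this
    omega

theorem jordanMatrix_minor (lam : K) (i j : JordanIndex ℓ k r) :
    ((augmentedMatrix (jordanMatrix ℓ k r lam)).submatrix ![i, j] id).det =
      rowVar K i (i.c + 1) * X j - X i * rowVar K j (j.c + 1) := by
  simp only [augmentedMatrix, Matrix.det_fin_two, Matrix.submatrix_apply, Matrix.of_apply,
    jordanMatrix_mulVec_X, id, Matrix.cons_val_zero, Matrix.cons_val_one]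
  ring

theorem rowVar_mul_sub_mem (lam : K) (i j : JordanIndex ℓ k r) {p q : ℕ} (hp : 1 ≤ p)
    (hq : 1 ≤ q) :
    rowVar K i (p + 1) * rowVar K j q - rowVar K i p * rowVar K j (q + 1) ∈
      matrixIdeal (jordanMatrix ℓ k r lam) := by
  by_cases hp' : p ≤ r i.a
  · by_cases hq' : q ≤ r j.a
    · have h := jordanMatrix_minor lam (i.atRow p hp hp') (j.atRow q hq hq')
      rw [rowVar_atRow, rowVar_atRow, ← rowVar_of_le i hp hp', ← rowVar_of_le j hq hq'] at h
      exact Ideal.subset_span ⟨_, _, h.symm⟩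
    · simp [rowVar_of_lt j (show r j.a < q by omega), rowVar_of_lt j (show r j.a < q + 1 by omega)]
  · simp [rowVar_of_lt i (show r i.a < p by omega), rowVar_of_lt i (show r i.a < p + 1 by omega)]

/-- Telescoping: each minor lowers the row in the block of `i` by one and raises the row in the
block of `j` by one. The zero convention of `rowVar` lets this run past the end of a block. -/
theorem rowVar_mul_sub_first_mem (lam : K) (i j : JordanIndex ℓ k r) (p : ℕ) {q : ℕ}
    (hq : 1 ≤ q) :
    rowVar K i (p + 1) * rowVar K j q - rowVar K i 1 * rowVar K j (p + q) ∈
      matrixIdeal (jordanMatrix ℓ k r lam) := by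
  induction p generalizing q with
  | zero => simp
  | succ p ih =>
    have h := add_mem (rowVar_mul_sub_mem lam i j (Nat.le_add_left 1 p) hq)
      (ih (q := q + 1) (by omega))
    rwa [sub_add_sub_cancel, show p + (q + 1) = p + 1 + q by ring] at h

/-- The polynomial `x(i⁺) x(j) - x(i^*) x(j^*)`, where the second term is absent if the block of
`j` has no row `i₃ + j₃`. -/
noncomputable def groebnerElement (K : Type*) [Field K] (i j : JordanIndex ℓ k r)
    (h : i.c < r i.a) : MvPolynomial (JordanIndex ℓ k r) K :=
  X (i.succRow h) * X j - rowVar K i 1 * rowVar K j (i.c + j.c)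

theorem groebnerElement_mem (lam : K) (i j : JordanIndex ℓ k r) (h : i.c < r i.a) :
    groebnerElement K i j h ∈ matrixIdeal (jordanMatrix ℓ k r lam) := by
  rw [groebnerElement, ← rowVar_succ, ← rowVar_self j]
  exact rowVar_mul_sub_first_mem lam i j i.c j.one_le_c

/-- Only the comparison of `i.c + j.c` with `r j.a` matters: since `1 ≤ i.c`, a last row `j` always
overflows, and absence of overflow forces `j` not to be last. -/
theorem mem_groebnerG₁_union_groebnerG₂ {p : MvPolynomial (JordanIndex ℓ k r) K} :
    p ∈ groebnerG₁ K ℓ k r ∪ groebnerG₂ K ℓ k r ↔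
      ∃ (i j : JordanIndex ℓ k r) (h : i.c < r i.a), j < i ∧ p = groebnerElement K i j h := by
  constructor
  · rintro (⟨i, j, h, rfl⟩ | ⟨i, j, h, rfl⟩)
    · have hlt : r j.a < i.c + j.c := by
        have := i.one_le_c
        rcases h with h | h
        · exact h.add_ge
        · have := h.right_eq
          omega
      refine ⟨i, j, h.elim Gamma₁.left_lt Gamma₃.left_lt, h.elim Gamma₁.gt Gamma₃.gt, ?_⟩
      rw [groebnerElement, rowVar_of_lt j hlt, mul_zero, sub_zero]
    · refine ⟨i, j, h.left_lt, h.gt, ?_⟩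
      rw [groebnerElement, rowVar_one, rowVar_of_le j (by have := i.one_le_c; omega) h.add_le]
  · rintro ⟨i, j, h, hij, rfl⟩
    have hj := j.c_le
    by_cases hle : i.c + j.c ≤ r j.a
    · have := i.one_le_c
      right
      refine ⟨i, j, ⟨hij, h, by omega, hle⟩, ?_⟩
      rw [groebnerElement, rowVar_one, rowVar_of_le j (by omega) hle]
    · left
      have hΓ : Gamma₁ i j ∨ Gamma₃ i j := by
        by_cases he : j.c = r j.a
        · exact Or.inr ⟨hij, h, he⟩
        · exact Or.inl ⟨hij, h, by omega, by omega⟩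
      refine ⟨i, j, hΓ, ?_⟩
      rw [groebnerElement, rowVar_of_lt j (by omega), mul_zero, sub_zero]

/-! ### Leading terms and reducedness -/

theorem X_mul_X_eq_monomial {σ : Type*} (i j : σ) :
    (X i * X j : MvPolynomial σ K) = monomial (Finsupp.single i 1 + Finsupp.single j 1) 1 := by
  simp [X, monomial_mul]

/-- The exponent vector of `x(i⁺) x(j)`. -/
noncomputable def leadingExponent (i j : JordanIndex ℓ k r) (h : i.c < r i.a) :
    JordanIndex ℓ k r →₀ ℕ :=
  Finsupp.single (i.succRow h) 1 + Finsupp.single j 1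

/-- Both monomials have degree 2, and `j^*` lies strictly below `j`, `i⁺` and `i^*`, so it is the
smallest variable at which they differ. -/
theorem grevlex_lt_leadingExponent {i j : JordanIndex ℓ k r} (h : i.c < r i.a) (hij : j < i)
    (h1 : 1 ≤ i.c + j.c) (h2 : i.c + j.c ≤ r j.a) :
    (grevlex (JordanIndex ℓ k r)).toSyn
        (Finsupp.single i.firstRow 1 + Finsupp.single (j.atRow (i.c + j.c) h1 h2) 1) <
      (grevlex (JordanIndex ℓ k r)).toSyn (leadingExponent i j h) := by
  classical
  refine (Grevlex.lt_iff _ _).2 (Or.inr ⟨by simp [leadingExponent], j.atRow (i.c + j.c) h1 h2, ?_⟩)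
  have hlt : j.atRow (i.c + j.c) h1 h2 < j :=
    atRow_lt h1 h2 (by have := i.one_le_c; omega)
  have hs := hlt.trans_le (le_succRow_of_lt h hij)
  have hf := hlt.trans (hij.trans_le i.le_firstRow)
  constructor
  · intro u hu
    simp [leadingExponent, hu.ne', (hu.trans hs).ne', (hu.trans hlt).ne',
      (hu.trans hf).ne']
  · simp [leadingExponent, hs.ne, hlt.ne]

theorem groebnerElement_degree_leadingCoeff {i j : JordanIndex ℓ k r} (h : i.c < r i.a)
    (hij : j < i) :
    (grevlex (JordanIndex ℓ k r)).degree (groebnerElement K i j h) = leadingExponent i j h ∧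
      (grevlex (JordanIndex ℓ k r)).leadingCoeff (groebnerElement K i j h) = 1 := by
  classical
  by_cases hle : i.c + j.c ≤ r j.a
  · have h1 : 1 ≤ i.c + j.c := by have := i.one_le_c; omega
    have hlt := grevlex_lt_leadingExponent h hij h1 hle
    rw [groebnerElement, rowVar_one, rowVar_of_le j h1 hle, X_mul_X_eq_monomial,
      X_mul_X_eq_monomial, MonomialOrder.degree_sub_of_lt, MonomialOrder.leadingCoeff_sub_of_lt,
      MonomialOrder.degree_monomial, MonomialOrder.leadingCoeff_monomial, if_neg one_ne_zero]
    · exact ⟨rfl, rfl⟩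
    all_goals
      rw [MonomialOrder.degree_monomial, MonomialOrder.degree_monomial, if_neg one_ne_zero,
        if_neg one_ne_zero]
      exact hlt
  · rw [groebnerElement, rowVar_of_lt j (by omega), mul_zero, sub_zero, X_mul_X_eq_monomial,
      MonomialOrder.degree_monomial, MonomialOrder.leadingCoeff_monomial, if_neg one_ne_zero]
    exact ⟨rfl, rfl⟩

theorem groebnerElement_leadingTerm {i j : JordanIndex ℓ k r} (h : i.c < r i.a) (hij : j < i) :
    (grevlex (JordanIndex ℓ k r)).leadingTerm (groebnerElement K i j h) =
      monomial (leadingExponent i j h) 1 := by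
  rw [MonomialOrder.leadingTerm, (groebnerElement_degree_leadingCoeff h hij).1,
    (groebnerElement_degree_leadingCoeff h hij).2]

theorem exponent_of_mem_support_groebnerElement {i j : JordanIndex ℓ k r} (h : i.c < r i.a)
    {d : JordanIndex ℓ k r →₀ ℕ} (hd : d ∈ (groebnerElement K i j h).support) :
    d = leadingExponent i j h ∨ ∃ (h1 : 1 ≤ i.c + j.c) (h2 : i.c + j.c ≤ r j.a),
      d = Finsupp.single i.firstRow 1 + Finsupp.single (j.atRow (i.c + j.c) h1 h2) 1 := by
  classical
  rw [groebnerElement] at hd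
  rcases Finset.mem_union.1 (support_sub _ _ _ hd) with hd | hd
  · rw [X_mul_X_eq_monomial] at hd
    exact Or.inl (Finset.mem_singleton.1 (support_monomial_subset hd))
  · right
    have h1 : 1 ≤ i.c + j.c := by have := i.one_le_c; omega
    by_cases hle : i.c + j.c ≤ r j.a
    · rw [rowVar_one, rowVar_of_le j h1 hle, X_mul_X_eq_monomial] at hd
      exact ⟨h1, hle, Finset.mem_singleton.1 (support_monomial_subset hd)⟩
    · simp [rowVar_of_lt j (show r j.a < i.c + j.c by omega)] at hd

theorem eq_or_eq_of_single_add_single_eq {σ : Type*} {u v u' v' : σ}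
    (h : Finsupp.single u 1 + Finsupp.single v 1 =
      (Finsupp.single u' 1 + Finsupp.single v' 1 : σ →₀ ℕ)) :
    u = u' ∧ v = v' ∨ u = v' ∧ v = u' := by
  classical
  have h1 := DFunLike.congr_fun h u
  have h2 := DFunLike.congr_fun h v
  have h3 := DFunLike.congr_fun h u'
  have h4 := DFunLike.congr_fun h v'
  simp only [Finsupp.add_apply, Finsupp.single_apply] at h1 h2 h3 h4
  grind

/-- From `j < i` follows `j ≤ i⁺`, so the unordered pair of variables already tells which one is
`i⁺`. -/
theorem leadingExponent_inj {i j i' j' : JordanIndex ℓ k r} {h : i.c < r i.a}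
    {h' : i'.c < r i'.a} (hij : j < i) (hij' : j' < i')
    (he : leadingExponent i j h = leadingExponent i' j' h') : i = i' ∧ j = j' := by
  rcases eq_or_eq_of_single_add_single_eq he with ⟨h1, h2⟩ | ⟨h1, h2⟩
  · exact ⟨succRow_inj h1, h2⟩
  · have h3 := le_succRow_of_lt h hij
    have h4 := le_succRow_of_lt h' hij'
    rw [← h1, ← h2] at h4
    have h5 := h4.antisymm h3
    exact ⟨succRow_inj (h5.trans h2), (h5.symm.trans h1)⟩

theorem first_add_ne_leadingExponent {i j i' j' : JordanIndex ℓ k r} (hij : j < i)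
    {h' : i'.c < r i'.a} (hij' : j' < i') (h1 : 1 ≤ i.c + j.c) (h2 : i.c + j.c ≤ r j.a) :
    leadingExponent i' j' h' ≠
      Finsupp.single i.firstRow 1 + Finsupp.single (j.atRow (i.c + j.c) h1 h2) 1 := by
  intro he
  rcases eq_or_eq_of_single_add_single_eq he with ⟨e1, e2⟩ | ⟨e1, e2⟩
  -- Here `i'⁺ = i^*`, but a successor row has number at least 2.
  · have := congrArg JordanIndex.c e1
    have := i'.one_le_c
    simp only [succRow, firstRow, atRow] at *
    omega
  -- Here `i'⁺ = j^*`, so `i'` is row `i.c + j.c - 1` of the block of `j`, hence `i' ≤ j`; yet `j' =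
  -- i^*` gives `j < i'`.
  · have hlt : j < i' := hij.trans ((i.le_firstRow.trans_eq e2.symm).trans_lt hij')
    rw [← gt_iff_lt, gt_iff] at hlt
    have := i.one_le_c
    simp only [succRow, atRow, JordanIndex.ext_iff] at e1
    omega

theorem eq_of_leadingExponent_le {i j : JordanIndex ℓ k r} {h : i.c < r i.a} {u v}
    (hle : leadingExponent i j h ≤ Finsupp.single u 1 + Finsupp.single v 1) :
    leadingExponent i j h = Finsupp.single u 1 + Finsupp.single v 1 := by
  obtain ⟨e, he⟩ := exists_add_of_le hle
  have hd := congrArg Finsupp.degree he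
  simp only [leadingExponent, map_add, Finsupp.degree_single] at hd
  have : e = 0 := (Finsupp.degree_eq_zero_iff e).1 (by omega)
  rw [he, this, add_zero]

theorem image_leadingTerm_eq {S : Set (MvPolynomial (JordanIndex ℓ k r) K)}
    (hS : S ⊆ groebnerG₁ K ℓ k r ∪ groebnerG₂ K ℓ k r) :
    (grevlex (JordanIndex ℓ k r)).leadingTerm '' S = (fun s => monomial s (1 : K)) ''
      {s | ∃ (i j : JordanIndex ℓ k r) (h : i.c < r i.a), j < i ∧ groebnerElement K i j h ∈ S ∧
        s = leadingExponent i j h} := by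
  ext p
  constructor
  · rintro ⟨g, hg, rfl⟩
    obtain ⟨i, j, h, hij, rfl⟩ := mem_groebnerG₁_union_groebnerG₂.1 (hS hg)
    exact ⟨_, ⟨i, j, h, hij, hg, rfl⟩, (groebnerElement_leadingTerm h hij).symm⟩
  · rintro ⟨_, ⟨i, j, h, hij, hg, rfl⟩, rfl⟩
    exact ⟨_, hg, groebnerElement_leadingTerm h hij⟩

theorem groebnerElement_reduced {g : MvPolynomial (JordanIndex ℓ k r) K}
    (hg : g ∈ groebnerG₁ K ℓ k r ∪ groebnerG₂ K ℓ k r) {d : JordanIndex ℓ k r →₀ ℕ}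
    (hd : d ∈ g.support) :
    monomial d (1 : K) ∉ Ideal.span ((grevlex (JordanIndex ℓ k r)).leadingTerm ''
      ((groebnerG₁ K ℓ k r ∪ groebnerG₂ K ℓ k r) \ {g})) := by
  classical
  rw [image_leadingTerm_eq Set.sdiff_subset, mem_ideal_span_monomial_image]
  intro H
  obtain ⟨_, ⟨i', j', h', hij', hmem, rfl⟩, hle⟩ := H d (by simp)
  obtain ⟨i, j, h, hij, rfl⟩ := mem_groebnerG₁_union_groebnerG₂.1 hg
  rcases exponent_of_mem_support_groebnerElement h hd with rfl | ⟨h1, h2, rfl⟩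
  · obtain ⟨rfl, rfl⟩ := leadingExponent_inj hij' hij (eq_of_leadingExponent_le hle)
    exact hmem.2 rfl
  · exact first_add_ne_leadingExponent hij hij' h1 h2 (eq_of_leadingExponent_le hle)

/-! ### Exponents of the block monomials -/

/-- The image of an exponent vector under `x(i) ↦ y(i₁, i₂) t ^ (i₃ - 1)`, where `none` stands for
the variable `t`. -/
noncomputable def blockExponent (ℓ : ℕ) (k r : ℕ → ℕ) :
    (JordanIndex ℓ k r →₀ ℕ) →+ (Option (ℕ × ℕ) →₀ ℕ) :=
  (Finsupp.linearCombination ℕ fun i : JordanIndex ℓ k r =>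
    Finsupp.single (some (i.a, i.b)) 1 + Finsupp.single none (i.c - 1)).toAddMonoidHom

theorem blockExponent_single (i : JordanIndex ℓ k r) (n : ℕ) :
    blockExponent ℓ k r (Finsupp.single i n) =
      Finsupp.single (some (i.a, i.b)) n + Finsupp.single none (n * (i.c - 1)) := by
  simp only [blockExponent, LinearMap.toAddMonoidHom_coe, Finsupp.linearCombination_single, smul_add,
    Finsupp.smul_single, smul_eq_mul, mul_one]

theorem blockExponent_mono {d e : JordanIndex ℓ k r →₀ ℕ} (h : d ≤ e) :
    blockExponent ℓ k r d ≤ blockExponent ℓ k r e := by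
  obtain ⟨f, rfl⟩ := exists_add_of_le h
  rw [map_add]
  exact le_self_add

theorem mul_le_blockExponent_none (d : JordanIndex ℓ k r →₀ ℕ) (i : JordanIndex ℓ k r) :
    d i * (i.c - 1) ≤ blockExponent ℓ k r d none := by
  have h := blockExponent_mono (show Finsupp.single i (d i) ≤ d by simp) none
  simpa [blockExponent_single] using h

theorem le_blockExponent_some (d : JordanIndex ℓ k r →₀ ℕ) (i : JordanIndex ℓ k r) :
    d i ≤ blockExponent ℓ k r d (some (i.a, i.b)) := by
  have h := blockExponent_mono (show Finsupp.single i (d i) ≤ d by simp) (some (i.a, i.b))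
  simpa [blockExponent_single] using h

theorem exists_of_blockExponent_some_ne_zero (d : JordanIndex ℓ k r →₀ ℕ) {x : ℕ × ℕ}
    (h : blockExponent ℓ k r d (some x) ≠ 0) :
    ∃ i : JordanIndex ℓ k r, d i ≠ 0 ∧ (i.a, i.b) = x := by
  classical
  contrapose! h
  induction d using Finsupp.induction with
  | zero => simp
  | single_add i n d hi hn ih =>
    have hi0 : d i = 0 := Finsupp.notMem_support_iff.1 hi
    have h1 := h i (by simp [hn])
    rw [map_add, Finsupp.add_apply, ih, blockExponent_single]
    · simp [h1]
    · intro j hj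
      exact h j (by simp [hj])

theorem blockExponent_none_eq_zero {d : JordanIndex ℓ k r →₀ ℕ} (h : ∀ u, d u ≠ 0 → u.c = 1) :
    blockExponent ℓ k r d none = 0 := by
  simp only [blockExponent, LinearMap.toAddMonoidHom_coe, Finsupp.linearCombination_apply,
    Finsupp.sum, Finsupp.finsetSum_apply]
  refine Finset.sum_eq_zero fun u hu => ?_
  simp [h u (Finsupp.mem_support_iff.1 hu)]

/-- Monomials with the same image therefore have the same degree, so grevlex compares them only by
its tie-break. -/
theorem degree_blockExponent (d : JordanIndex ℓ k r →₀ ℕ) :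
    (blockExponent ℓ k r d).degree = d.degree + blockExponent ℓ k r d none := by
  induction d using Finsupp.induction_linear with
  | zero => simp
  | add d e hd he =>
    simp only [map_add, Finsupp.add_apply, hd, he]
    ring
  | single i n =>
    simp only [blockExponent_single, map_add, Finsupp.degree_single, Finsupp.add_apply]
    simp [-Finsupp.single_mul, -Finsupp.single_tsub]

theorem c_eq_one_of_blockExponent_none_eq_zero {d : JordanIndex ℓ k r →₀ ℕ}
    (h : blockExponent ℓ k r d none = 0) {i : JordanIndex ℓ k r} (hi : d i ≠ 0) : i.c = 1 := by
  have h1 := mul_le_blockExponent_none d i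
  rw [h, Nat.le_zero, mul_eq_zero] at h1
  have := i.one_le_c
  have := h1.resolve_left hi
  omega

/-- Without a factor `t` only first rows occur, one per block, so the exponent of each `y` is the
exponent of a single variable. -/
theorem blockExponent_some_of_rows_eq_one {d : JordanIndex ℓ k r →₀ ℕ}
    (h : blockExponent ℓ k r d none = 0) (i : JordanIndex ℓ k r) :
    d i = if i.c = 1 then blockExponent ℓ k r d (some (i.a, i.b)) else 0 := by
  classical
  split_ifs with hi
  · obtain ⟨e, he⟩ := exists_add_of_le (show Finsupp.single i (d i) ≤ d by simp)
    have h0 : e i = 0 := by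
      have := DFunLike.congr_fun he i
      simpa using this
    have hz : blockExponent ℓ k r e (some (i.a, i.b)) = 0 := by
      by_contra hne
      obtain ⟨j, hj, hji⟩ := exists_of_blockExponent_some_ne_zero e hne
      have hj1 := c_eq_one_of_blockExponent_none_eq_zero h (i := j) (by rw [he]; simp [hj])
      rw [Prod.mk.injEq] at hji
      rw [JordanIndex.ext hji.1 hji.2 (hj1.trans hi.symm)] at hj
      exact hj h0
    conv_rhs => rw [he]
    simp [blockExponent_single, hz]
  · by_contra hd
    exact hi (c_eq_one_of_blockExponent_none_eq_zero h hd)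

theorem eq_of_blockExponent_eq_of_none_eq_zero {d e : JordanIndex ℓ k r →₀ ℕ}
    (h : blockExponent ℓ k r d = blockExponent ℓ k r e) (h0 : blockExponent ℓ k r d none = 0) :
    d = e := by
  ext i
  rw [blockExponent_some_of_rows_eq_one h0, blockExponent_some_of_rows_eq_one (h ▸ h0), h]

/-! ### Standard exponents -/

/-- An exponent vector is standard if it is not divisible by any `x(i⁺) x(j)` with `i > j`. -/
def IsStandardExponent (d : JordanIndex ℓ k r →₀ ℕ) : Prop :=
  ∀ (i j : JordanIndex ℓ k r) (h : i.c < r i.a), j < i → ¬ leadingExponent i j h ≤ d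

theorem IsStandardExponent.eq_single_add {d : JordanIndex ℓ k r →₀ ℕ} (hd : IsStandardExponent d)
    {v : JordanIndex ℓ k r} (hv : d v ≠ 0) (hc : v.c ≠ 1) :
    ∃ e : JordanIndex ℓ k r →₀ ℕ, d = Finsupp.single v 1 + e ∧
      blockExponent ℓ k r e none = 0 ∧ ∀ u, e u ≠ 0 → v < u := by
  classical
  -- A row `w` other than the first is `i⁺` for the row `i` just above it, and `u ≤ w < i`, so `x(w)
  -- x(u)` is a leading monomial. This also forbids `u = w`.
  have key : ∀ w u e, w.c ≠ 1 → u ≤ w →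
      d ≠ Finsupp.single w 1 + (Finsupp.single u 1 + e) := by
    intro w u e hw hu he
    have h1 := w.one_le_c
    have h2 := w.c_le
    refine hd (w.atRow (w.c - 1) (by omega) (by omega)) u (by simp only [atRow]; omega) ?_ ?_
    · refine hu.trans_lt ?_
      exact (gt_iff _ _).2 (Or.inr (Or.inr ⟨rfl, rfl, show w.c - 1 < w.c by omega⟩))
    · have hs : (w.atRow (w.c - 1) (by omega) (by omega)).succRow
          (by simp only [atRow]; omega) = w := by
        exact JordanIndex.ext rfl rfl (show w.c - 1 + 1 = w.c by omega)
      rw [leadingExponent, hs, he, ← add_assoc]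
      exact le_self_add
  obtain ⟨e, he⟩ := exists_add_of_le (show Finsupp.single v 1 ≤ d by
    rw [Finsupp.single_le_iff]; omega)
  have hlt : ∀ u, e u ≠ 0 → v < u := by
    intro u hu
    obtain ⟨f, hf⟩ := exists_add_of_le (show Finsupp.single u 1 ≤ e by
      rw [Finsupp.single_le_iff]; omega)
    rw [hf] at he
    exact not_le.1 fun hle => key v u f hc hle he
  refine ⟨e, he, ?_, hlt⟩
  have hrow : ∀ u, e u ≠ 0 → u.c = 1 := by
    intro u hu
    by_contra huc
    obtain ⟨f, hf⟩ := exists_add_of_le (show Finsupp.single u 1 ≤ e by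
      rw [Finsupp.single_le_iff]; omega)
    rw [hf, add_left_comm] at he
    exact key u v f huc (hlt u hu).le he
  exact blockExponent_none_eq_zero hrow

theorem IsStandardExponent.eq_of_blockExponent_eq_of_le {d m : JordanIndex ℓ k r →₀ ℕ}
    (hd : IsStandardExponent d) (h : blockExponent ℓ k r m = blockExponent ℓ k r d)
    (hlt : (grevlex (JordanIndex ℓ k r)).toSyn m ≤ (grevlex (JordanIndex ℓ k r)).toSyn d) :
    m = d := by
  classical
  by_cases h0 : blockExponent ℓ k r d none = 0
  · exact eq_of_blockExponent_eq_of_none_eq_zero h (h ▸ h0)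
  obtain ⟨v, hv, hc⟩ : ∃ v : JordanIndex ℓ k r, d v ≠ 0 ∧ v.c ≠ 1 := by
    by_contra! H
    exact h0 (blockExponent_none_eq_zero H)
  obtain ⟨e, rfl, he0, he⟩ := hd.eq_single_add hv hc
  have hnone : blockExponent ℓ k r m none = v.c - 1 := by
    simp [h, blockExponent_single, he0]
  -- Once `x(v)` divides `m`, it carries the whole power of `t`, and the cofactor is determined by
  -- its image.
  have hmv : m v ≠ 0 → m = Finsupp.single v 1 + e := by
    intro hm
    obtain ⟨f, rfl⟩ := exists_add_of_le (show Finsupp.single v 1 ≤ m by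
      rw [Finsupp.single_le_iff]; omega)
    rw [map_add, map_add, add_right_inj] at h
    rw [eq_of_blockExponent_eq_of_none_eq_zero h (h ▸ he0)]
  by_contra hne
  have hev : e v = 0 := by
    by_contra hev
    exact lt_irrefl v (he v hev)
  have hlt' := lt_of_le_of_ne hlt fun h' => hne ((grevlex (JordanIndex ℓ k r)).toSyn.injective h')
  rcases (Grevlex.lt_iff _ _).1 hlt' with hdeg | ⟨hdeg, s, hs, hms⟩
  · have h1 := degree_blockExponent m
    have h2 := degree_blockExponent (Finsupp.single v 1 + e)
    rw [h] at h1
    omega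
  · rcases lt_trichotomy s v with hsv | rfl | hsv
    -- The power of `t` gives `s.c ≤ v.c`. Some `u ≥ v` dividing `d` shares the block of `s`, and
    -- blocks are intervals of the order, so `s < v ≤ u` puts `v` in that block too; then `s < v`
    -- means `s.c > v.c`.
    · have hms0 : m s ≠ 0 := by omega
      have h1 := mul_le_blockExponent_none m s
      have h2 : s.c - 1 ≤ m s * (s.c - 1) := Nat.le_mul_of_pos_left _ (by omega)
      have h3 := le_blockExponent_some m s
      rw [h] at h3
      obtain ⟨u, hu, hus⟩ := exists_of_blockExponent_some_ne_zero _
        (show blockExponent ℓ k r (Finsupp.single v 1 + e) (some (s.a, s.b)) ≠ 0 by omega)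
      have hvu : v ≤ u := by
        by_cases huv : u = v
        · exact huv.ge
        · refine (he u ?_).le
          intro h4
          simp [h4, Ne.symm huv] at hu
      have h5 := hsv.trans_le hvu
      rw [← gt_iff_lt, gt_iff] at hsv h5
      rw [← not_lt, ← gt_iff_lt, gt_iff] at hvu
      rw [Prod.mk.injEq] at hus
      have := s.one_le_c
      have := v.one_le_c
      omega
    · exact hne (hmv (by omega))
    · refine hne (hmv ?_)
      rw [hs v hsv]
      exact hv

/-- The power of `t` is `v.c - 1` for the single variable `v` beyond a first row. As `v` is the
smallest variable of `d`, its block is no longer than any other that occurs. -/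
theorem IsStandardExponent.blockExponent_none_lt {d : JordanIndex ℓ k r →₀ ℕ}
    (hanti : StrictAntiOn r (Set.Icc 1 ℓ)) (hd : IsStandardExponent d) {u : JordanIndex ℓ k r}
    (hu : d u ≠ 0) : blockExponent ℓ k r d none < r u.a := by
  classical
  have hu1 := u.one_le_c
  have hu2 := u.c_le
  by_cases H : ∀ v, d v ≠ 0 → v.c = 1
  · rw [blockExponent_none_eq_zero H]
    omega
  push Not at H
  obtain ⟨v, hv, hc⟩ := H
  obtain ⟨e, rfl, he0, he⟩ := hd.eq_single_add hv hc
  have hvu : v ≤ u := by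
    by_cases huv : u = v
    · exact huv.ge
    · refine (he u ?_).le
      intro h4
      simp [h4, Ne.symm huv] at hu
  have hv1 := v.one_le_c
  have hv2 := v.c_le
  have hr : r v.a ≤ r u.a := by
    refine hanti.antitoneOn ⟨u.one_le_a, u.a_le⟩ ⟨v.one_le_a, v.a_le⟩ ?_
    rw [← not_lt, ← gt_iff_lt, gt_iff] at hvu
    omega
  simp only [map_add, blockExponent_single, Finsupp.add_apply, he0]
  simp
  omega

/-! ### The homomorphism to block monomials and the image of the ideal -/

/-- The homomorphism `x(i) ↦ y(i₁, i₂) t ^ (i₃ - 1)`. -/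
noncomputable def blockHom (K : Type*) [Field K] (ℓ : ℕ) (k r : ℕ → ℕ) :
    MvPolynomial (JordanIndex ℓ k r) K →ₐ[K] MvPolynomial (Option (ℕ × ℕ)) K :=
  aeval fun i => monomial (blockExponent ℓ k r (Finsupp.single i 1)) 1

theorem blockHom_X (i : JordanIndex ℓ k r) :
    blockHom K ℓ k r (X i) = X (some (i.a, i.b)) * X none ^ (i.c - 1) := by
  rw [blockHom, aeval_X, blockExponent_single, one_mul, X_pow_eq_monomial, X, monomial_mul,
    one_mul]

theorem blockHom_monomial (d : JordanIndex ℓ k r →₀ ℕ) (c : K) :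
    blockHom K ℓ k r (monomial d c) = monomial (blockExponent ℓ k r d) c := by
  induction d using Finsupp.induction_linear generalizing c with
  | zero => rw [map_zero, ← C_apply, ← C_apply, ← algebraMap_eq, AlgHom.commutes, algebraMap_eq]
  | add d e hd he => rw [← mul_one c, ← monomial_mul, map_mul, hd, he, monomial_mul, map_add]
  | single i n =>
    rw [blockHom, aeval_monomial, Finsupp.prod_single_index (by simp), monomial_pow, one_pow,
      algebraMap_eq, C_mul_monomial, mul_one, ← map_nsmul, Finsupp.smul_single, smul_eq_mul,
      mul_one]

theorem coeff_blockHom (T : Option (ℕ × ℕ) →₀ ℕ) (f : MvPolynomial (JordanIndex ℓ k r) K) :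
    coeff T (blockHom K ℓ k r f) =
      ∑ d ∈ f.support, if blockExponent ℓ k r d = T then coeff d f else 0 := by
  classical
  conv_lhs => rw [f.as_sum]
  simp only [map_sum, blockHom_monomial, coeff_sum, coeff_monomial]

/-- The ideal generated by the monomials `y(i₁, i₂) t ^ r_{i₁}`. -/
noncomputable def blockIdeal (K : Type*) [Field K] (ℓ : ℕ) (k r : ℕ → ℕ) :
    Ideal (MvPolynomial (Option (ℕ × ℕ)) K) :=
  Ideal.span ((fun s => monomial s (1 : K)) '' Set.range fun i : JordanIndex ℓ k r =>
    Finsupp.single (some (i.a, i.b)) 1 + Finsupp.single none (r i.a))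

theorem X_mul_X_none_pow_mem_blockIdeal (i : JordanIndex ℓ k r) :
    X (some (i.a, i.b)) * X none ^ r i.a ∈ blockIdeal K ℓ k r := by
  refine Ideal.subset_span ⟨_, ⟨i, rfl⟩, ?_⟩
  simp [X, monomial_pow, monomial_mul]

theorem blockHom_rowVar_succ_sub_mem (i : JordanIndex ℓ k r) :
    blockHom K ℓ k r (rowVar K i (i.c + 1)) - X (some (i.a, i.b)) * X none ^ i.c ∈
      blockIdeal K ℓ k r := by
  by_cases h : i.c < r i.a
  · rw [rowVar_succ i h, blockHom_X]
    simp [succRow, atRow]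
  · have hc : i.c = r i.a := le_antisymm i.c_le (not_lt.1 h)
    rw [rowVar_of_lt i (by omega), map_zero, zero_sub, neg_mem_iff, hc]
    exact X_mul_X_none_pow_mem_blockIdeal i

/-- Modulo `blockIdeal` the first column, cleared of `lam`, becomes `t` times the second, even in
last rows, where `y(i₁, i₂) t ^ r_{i₁}` vanishes. So the minors vanish. -/
theorem blockHom_mem_blockIdeal (lam : K) {f : MvPolynomial (JordanIndex ℓ k r) K}
    (hf : f ∈ matrixIdeal (jordanMatrix ℓ k r lam)) :
    blockHom K ℓ k r f ∈ blockIdeal K ℓ k r := by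
  suffices h : matrixIdeal (jordanMatrix ℓ k r lam) ≤
      (blockIdeal K ℓ k r).comap (blockHom K ℓ k r) from h hf
  refine Ideal.span_le.2 ?_
  rintro _ ⟨i, j, rfl⟩
  rw [jordanMatrix_minor, SetLike.mem_coe, Ideal.mem_comap, map_sub, map_mul, map_mul]
  have h1 := Ideal.mul_mem_right (blockHom K ℓ k r (X j)) _
    (blockHom_rowVar_succ_sub_mem (K := K) i)
  have h2 := Ideal.mul_mem_left _ (blockHom K ℓ k r (X i)) (blockHom_rowVar_succ_sub_mem (K := K) j)
  have hpow : ∀ i : JordanIndex ℓ k r, (X none : MvPolynomial (Option (ℕ × ℕ)) K) ^ i.c =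
      X none ^ (i.c - 1) * X none := fun i => by
    rw [← pow_succ, Nat.sub_add_cancel i.one_le_c]
  convert sub_mem h1 h2 using 1
  rw [blockHom_X, blockHom_X, hpow i, hpow j]
  ring

theorem coeff_eq_zero_of_mem_blockIdeal {T : Option (ℕ × ℕ) →₀ ℕ}
    (hT : ∀ i : JordanIndex ℓ k r, T (some (i.a, i.b)) ≠ 0 → T none < r i.a)
    {f : MvPolynomial (Option (ℕ × ℕ)) K} (hf : f ∈ blockIdeal K ℓ k r) : coeff T f = 0 := by
  by_contra hne
  obtain ⟨_, ⟨i, rfl⟩, hle⟩ := mem_ideal_span_monomial_image.1 hf T (mem_support_iff.2 hne)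
  have h1 := hle (some (i.a, i.b))
  have h2 := hle none
  simp at h1 h2
  have := hT i (by omega)
  omega

/-! ### The initial ideal and the conclusion -/

theorem not_isStandardExponent_degree (lam : K) (hanti : StrictAntiOn r (Set.Icc 1 ℓ))
    {f : MvPolynomial (JordanIndex ℓ k r) K} (hf : f ∈ matrixIdeal (jordanMatrix ℓ k r lam))
    (hf0 : f ≠ 0) : ¬ IsStandardExponent ((grevlex (JordanIndex ℓ k r)).degree f) := by
  intro hd
  set d := (grevlex (JordanIndex ℓ k r)).degree f with hdef
  have hcoeff : coeff d f ≠ 0 := MonomialOrder.coeff_degree_ne_zero_iff.2 hf0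
  have h0 : coeff (blockExponent ℓ k r d) (blockHom K ℓ k r f) = 0 := by
    refine coeff_eq_zero_of_mem_blockIdeal (fun i hi => ?_) (blockHom_mem_blockIdeal lam hf)
    obtain ⟨u, hu, hui⟩ := exists_of_blockExponent_some_ne_zero d hi
    rw [Prod.mk.injEq] at hui
    rw [← hui.1]
    exact hd.blockExponent_none_lt hanti hu
  rw [coeff_blockHom, Finset.sum_eq_single d, if_pos rfl] at h0
  · exact hcoeff h0
  -- Every other exponent of `f` is below `d`, and nothing below `d` shares its image.
  · intro m hm hmd
    refine if_neg fun h => hmd ?_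
    exact hd.eq_of_blockExponent_eq_of_le h (MonomialOrder.le_degree hm)
  · intro h
    exact absurd (mem_support_iff.2 hcoeff) h

theorem matrixIdeal_jordanMatrix_eq_bot (lam : K) (hanti : StrictAntiOn r (Set.Icc 1 ℓ))
    (h1 : r 1 = 1) : matrixIdeal (jordanMatrix ℓ k r lam) = ⊥ := by
  refine Ideal.span_eq_bot.2 ?_
  rintro _ ⟨i, j, rfl⟩
  have hr : ∀ i : JordanIndex ℓ k r, r i.a < i.c + 1 := fun i => by
    have := hanti.antitoneOn ⟨le_rfl, i.one_le_a.trans i.a_le⟩ ⟨i.one_le_a, i.a_le⟩ i.one_le_a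
    have := i.one_le_c
    omega
  rw [jordanMatrix_minor, rowVar_of_lt i (hr i), rowVar_of_lt j (hr j), zero_mul, mul_zero,
    sub_zero]

theorem matrixIdeal_jordanMatrix_ne_bot (lam : K) (hℓ : 1 ≤ ℓ) (hk : 1 ≤ k 1) (h1 : 2 ≤ r 1) :
    matrixIdeal (jordanMatrix ℓ k r lam) ≠ ⊥ := by
  -- Pairing this index with `j = i⁺` gives an element of the ideal with leading term `x(i⁺) ^ 2`.
  let i : JordanIndex ℓ k r := ⟨1, 1, 1, le_rfl, hℓ, le_rfl, hk, le_rfl, by omega⟩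
  have hlt : i.c < r i.a := h1
  have hij : i.succRow hlt < i := atRow_lt _ _ (Nat.lt_succ_self _)
  intro h
  have hmem := groebnerElement_mem lam i (i.succRow hlt) hlt
  rw [h, Ideal.mem_bot] at hmem
  have := (groebnerElement_degree_leadingCoeff (K := K) hlt hij).2
  rw [hmem, MonomialOrder.leadingCoeff_zero] at this
  exact zero_ne_one this

theorem span_leadingTerm_eq (lam : K) (hanti : StrictAntiOn r (Set.Icc 1 ℓ)) :
    Ideal.span ((grevlex (JordanIndex ℓ k r)).leadingTerm ''
      (groebnerG₁ K ℓ k r ∪ groebnerG₂ K ℓ k r)) =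
    Ideal.span ((grevlex (JordanIndex ℓ k r)).leadingTerm ''
      (matrixIdeal (jordanMatrix ℓ k r lam) : Set (MvPolynomial (JordanIndex ℓ k r) K))) := by
  refine le_antisymm (Ideal.span_mono (Set.image_mono fun p hp => ?_)) (Ideal.span_le.2 ?_)
  · obtain ⟨i, j, h, -, rfl⟩ := mem_groebnerG₁_union_groebnerG₂.1 hp
    exact groebnerElement_mem lam i j h
  · rintro _ ⟨f, hf, rfl⟩
    by_cases hf0 : f = 0
    · rw [hf0, MonomialOrder.leadingTerm_zero]
      exact zero_mem _
    · have hd := not_isStandardExponent_degree lam hanti hf hf0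
      simp only [IsStandardExponent, not_forall, not_not] at hd
      obtain ⟨i, j, h, hij, hle⟩ := hd
      rw [SetLike.mem_coe, image_leadingTerm_eq subset_rfl, mem_ideal_span_monomial_image]
      intro x hx
      rw [Finset.mem_singleton.1 (support_monomial_subset hx)]
      exact ⟨_, ⟨i, j, h, hij, mem_groebnerG₁_union_groebnerG₂.2 ⟨i, j, h, hij, rfl⟩, rfl⟩, hle⟩

theorem finite_groebnerG₁_union_groebnerG₂ :
    (groebnerG₁ K ℓ k r ∪ groebnerG₂ K ℓ k r).Finite := by
  refine (Set.finite_range fun p : {i : JordanIndex ℓ k r // i.c < r i.a} × JordanIndex ℓ k r =>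
    groebnerElement K p.1.1 p.2 p.1.2).subset fun p hp => ?_
  obtain ⟨i, j, h, -, rfl⟩ := mem_groebnerG₁_union_groebnerG₂.1 hp
  exact ⟨(⟨i, h⟩, j), rfl⟩

end

theorem mainTheorem6 {K : Type*} [Field K] (lam : K) (ℓ : ℕ) (hℓ : 1 ≤ ℓ) (k r : ℕ → ℕ)
    (hk : ∀ a ∈ Set.Icc 1 ℓ, 1 ≤ k a) (hr : ∀ a ∈ Set.Icc 1 ℓ, 1 ≤ r a)
    (hanti : StrictAntiOn r (Set.Icc 1 ℓ)) :
    IsReducedGroebnerBasis (grevlex (JordanIndex ℓ k r)) (groebnerG K ℓ k r)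
      (matrixIdeal (jordanMatrix ℓ k r lam)) := by
  have h1 : 1 ∈ Set.Icc 1 ℓ := ⟨le_rfl, hℓ⟩
  by_cases hr1 : r 1 = 1
  · rw [groebnerG, if_pos hr1, matrixIdeal_jordanMatrix_eq_bot lam hanti hr1]
    refine ⟨⟨Set.finite_singleton 0, by simp, by simp⟩, fun _ => rfl, fun h => absurd rfl h⟩
  · rw [groebnerG, if_neg hr1]
    have hne : matrixIdeal (jordanMatrix ℓ k r lam) ≠ ⊥ :=
      matrixIdeal_jordanMatrix_ne_bot lam hℓ (hk 1 h1) (by have := hr 1 h1; omega)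
    refine ⟨⟨finite_groebnerG₁_union_groebnerG₂, fun p hp => ?_, span_leadingTerm_eq lam hanti⟩,
      fun h => absurd h hne, fun _ => ⟨fun g hg => ?_, fun g hg d hd =>
        groebnerElement_reduced hg hd⟩⟩
    · obtain ⟨i, j, h, -, rfl⟩ := mem_groebnerG₁_union_groebnerG₂.1 hp
      exact groebnerElement_mem lam i j h
    · obtain ⟨i, j, h, hij, rfl⟩ := mem_groebnerG₁_union_groebnerG₂.1 hg
      exact (groebnerElement_degree_leadingCoeff h hij).2
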